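/- Let $k$ be a field and let $h\ge 2$ be an integer. Consider the degree reverse lexicographic monomial order on $k[x_1,x_2,x_3,x_4]$ induced by $x_1>x_2>x_3>x_4$. Let $\mathfrak{Q}_h$ be the defining ideal of the Bresinsky curve, i.e. the kernel of the $k$-algebra homomorphism $\eta\colon k[x_1,x_2,x_3,x_4]\to k[t]$ with $$\eta(x_1)=t^{(2h-1)2h},\quad \eta(x_2)=t^{(2h-1)(2h+1)},\quad \eta(x_3)=t^{2h(2h+1)},\quad \eta(x_4)=t^{2h(2h+1)+2h-1}.$$ Consider the following polynomials: \begin{itemize} \item $p_{1}=x_{2}x_{3}-x_{1}x_{4}$, \item $p_{2}=x_{2}^{2h}-x_{3}^{2h-1}$, \item $p_{(3,j)}=x_{1}^{j+1}x_{3}^{2h-j}-x_{2}^{j}x_{4}^{2h-j}$ for $0\le j\le 2h-1$, \item $p_{(4,i)}=x_{1}^{i+1}x_{2}^{2h-i}-x_{3}^{i-1}x_{4}^{2h-i}$ for $1\le i\le 2h$, \item $p_{5}=x_{3}^{4h}-x_{2}^{2h-1}x_{4}^{2h+1}$, \item $p_{(6,i)}=x_{1}^{2+i}x_{2}^{2h-2-i}x_{4}^{2+i}-x_{3}^{2h+1+i}$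 for $0\le i\le 2h-3$, \item $p_{7}=x_{1}x_{2}^{2h-1}x_{4}-x_{3}^{2h}$, \item $p_{8}=x_{1}^{2h}x_{4}^{2h}-x_{3}^{4h-1}$. \end{itemize} Let $$\mathfrak{G}_h=\{p_1,p_2,p_5,p_7,p_8\}\cup\{p_{(3,j)}\mid 0\le j\le 2h-1\}\cup\{p_{(4,i)}\mid 1\le i\le 2h\}\cup\{p_{(6,i)}\mid 0\le i\le 2h-3\}.$$ Then $\mathfrak{G}_h$ is a Gröbner basis of $\mathfrak{Q}_h$ with respect to the given monomial order, i.e. $\mathfrak{G}_h$ is a finite subset of $\mathfrak{Q}_h$ and the leading terms of its elements generate the ideal generated by the leading terms of all elements of $\mathfrak{Q}_h$. -/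

import Mathlib

/-! ### The degree reverse lexicographic order

As for Mathlib's `MonomialOrder.lex` and `MonomialOrder.degLex`, smaller indices are larger
variables: on `Fin 4` one has `X 0 > X 1 > X 2 > X 3`. -/

/-- Exponent vectors, to be ordered by the degree reverse lexicographic order. -/
def DegRevLex (σ : Type*) : Type _ := σ →₀ ℕ

namespace DegRevLex

variable {σ : Type*}

/-- The identity map onto the type synonym. -/
def of : (σ →₀ ℕ) ≃ DegRevLex σ := Equiv.refl _

/-- The sort key of an exponent vector: first its total degree, then the reverse of the
colexicographic order. -/
noncomputable def key (a : σ →₀ ℕ) : ℕ ×ₗ (Colex (σ →₀ ℕ))ᵒᵈ :=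
  toLex (a.degree, OrderDual.toDual (toColex a))

theorem key_injective : Function.Injective (key (σ := σ)) := fun a b h ↦ by
  simpa [key] using congrArg (fun x ↦ ofColex (OrderDual.ofDual (ofLex x).2)) h

noncomputable instance : AddCommMonoid (DegRevLex σ) := of.symm.addCommMonoid

theorem of_add (a b : σ →₀ ℕ) : of (a + b) = of a + of b := rfl

noncomputable instance [LinearOrder σ] : LinearOrder (DegRevLex σ) :=
  LinearOrder.lift' (fun a ↦ key (of.symm a)) (key_injective.comp of.symm.injective)

variable [LinearOrder σ]

theorem of_le_of {a b : σ →₀ ℕ} :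
    of a ≤ of b ↔ a.degree < b.degree ∨ a.degree = b.degree ∧ toColex b ≤ toColex a := by
  change key a ≤ key b ↔ _
  simp [key, Prod.Lex.toLex_le_toLex]

theorem of_lt_of {a b : σ →₀ ℕ} :
    of a < of b ↔ a.degree < b.degree ∨ a.degree = b.degree ∧ toColex b < toColex a := by
  change key a < key b ↔ _
  simp [key, Prod.Lex.toLex_lt_toLex]

instance : IsOrderedAddMonoid (DegRevLex σ) where
  add_le_add_left a b h c := by
    obtain ⟨a, rfl⟩ := of.surjective a
    obtain ⟨b, rfl⟩ := of.surjective b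
    obtain ⟨c, rfl⟩ := of.surjective c
    rw [of_le_of] at h
    rw [← of_add, ← of_add, of_le_of, map_add, map_add]
    rcases h with h | ⟨h, h'⟩
    · left; omega
    · right; exact ⟨by omega, add_le_add_left h' (toColex c)⟩

theorem of_monotone : Monotone (of (σ := σ)) := fun a b h ↦ by
  obtain ⟨c, rfl⟩ := exists_add_of_le h
  rw [of_le_of, map_add]
  rcases Nat.eq_zero_or_pos c.degree with hc | hc
  · right
    rw [Finsupp.degree_eq_zero_iff] at hc
    simp [hc]
  · left; omega

instance [Finite σ] : WellFoundedLT (DegRevLex σ) := by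
  have : WellQuasiOrderedLE (DegRevLex σ) := ⟨fun f ↦ by
    obtain ⟨i, j, hij, h⟩ :=
      (Finsupp.wellQuasiOrderedLE (α := ℕ) (σ := σ)).wqo (fun n ↦ of.symm (f n))
    exact ⟨i, j, hij, of_monotone h⟩⟩
  infer_instance

end DegRevLex

/-- The degree reverse lexicographic monomial order in finitely many variables. -/
noncomputable def MonomialOrder.degRevLex (σ : Type*) [LinearOrder σ] [Finite σ] :
    MonomialOrder σ where
  syn := DegRevLex σ
  toSyn := { toEquiv := DegRevLex.of, map_add' := DegRevLex.of_add }
  toSyn_monotone := DegRevLex.of_monotone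

open scoped MonomialOrder in
/-- The usual description: `x ^ a < x ^ b` iff the total degree of `a` is smaller, or the total
degrees agree and, at the last index at which `a` and `b` differ, `a` has the larger entry. -/
theorem MonomialOrder.degRevLex_lt_iff {σ : Type*} [LinearOrder σ] [Finite σ] {a b : σ →₀ ℕ} :
    a ≺[MonomialOrder.degRevLex σ] b ↔ a.degree < b.degree ∨
      a.degree = b.degree ∧ ∃ i, (∀ j, i < j → a j = b j) ∧ b i < a i := by
  change DegRevLex.of a < DegRevLex.of b ↔ _
  rw [DegRevLex.of_lt_of, Finsupp.Colex.lt_iff]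
  simp [eq_comm]

/-! ### Gröbner bases -/

/-- `G` is a Gröbner basis of the ideal `I` for the monomial order `m`: a finite subset of `I`
whose leading terms generate the ideal generated by the leading terms of all elements of `I`
(the leading term of `0` is `0`). -/
def IsGroebnerBasis {σ k : Type*} [Field k] (m : MonomialOrder σ)
    (G : Set (MvPolynomial σ k)) (I : Ideal (MvPolynomial σ k)) : Prop :=
  G.Finite ∧ G ⊆ I ∧ Ideal.span (m.leadingTerm '' G) = Ideal.span (m.leadingTerm '' I)

/-! ### Monomial curves and the Bresinsky family -/

/-- The defining ideal of the affine monomial curve with exponents `n`: the kernel of the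
`k`-algebra map `k[x_i] → k[t]`, `x_i ↦ t ^ n_i`. -/
noncomputable def monomialCurveIdeal (k : Type*) [Field k] {σ : Type*} (n : σ → ℕ) :
    Ideal (MvPolynomial σ k) :=
  RingHom.ker (MvPolynomial.aeval (R := k) fun i ↦ (Polynomial.X : Polynomial k) ^ n i)

namespace Bresinsky

open MvPolynomial

/-- The exponents of Bresinsky's curve, for `1 ≤ h`. -/
def exponents (h : ℕ) : Fin 4 → ℕ :=
  ![(2 * h - 1) * (2 * h), (2 * h - 1) * (2 * h + 1), 2 * h * (2 * h + 1),
    2 * h * (2 * h + 1) + (2 * h - 1)]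

variable (k : Type*) [Field k]

/-- The defining ideal of Bresinsky's curve. -/
noncomputable def curveIdeal (h : ℕ) : Ideal (MvPolynomial (Fin 4) k) :=
  monomialCurveIdeal k (exponents h)

/-! The variables `x₁, x₂, x₃, x₄` are `X 0, X 1, X 2, X 3`. The exponents below involve no
truncated subtraction when `2 ≤ h` and the indices lie in the ranges used in `basis`. -/

/-- `x₂ x₃ - x₁ x₄` -/
noncomputable def p₁ : MvPolynomial (Fin 4) k := X 1 * X 2 - X 0 * X 3

/-- `x₂ ^ (2h) - x₃ ^ (2h - 1)` -/
noncomputable def p₂ (h : ℕ) : MvPolynomial (Fin 4) k := X 1 ^ (2 * h) - X 2 ^ (2 * h - 1)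

/-- `x₁ ^ (j + 1) x₃ ^ (2h - j) - x₂ ^ j x₄ ^ (2h - j)` -/
noncomputable def p₃ (h j : ℕ) : MvPolynomial (Fin 4) k :=
  X 0 ^ (j + 1) * X 2 ^ (2 * h - j) - X 1 ^ j * X 3 ^ (2 * h - j)

/-- `x₁ ^ (i + 1) x₂ ^ (2h - i) - x₃ ^ (i - 1) x₄ ^ (2h - i)` -/
noncomputable def p₄ (h i : ℕ) : MvPolynomial (Fin 4) k :=
  X 0 ^ (i + 1) * X 1 ^ (2 * h - i) - X 2 ^ (i - 1) * X 3 ^ (2 * h - i)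

/-- `x₃ ^ (4h) - x₂ ^ (2h - 1) x₄ ^ (2h + 1)` -/
noncomputable def p₅ (h : ℕ) : MvPolynomial (Fin 4) k :=
  X 2 ^ (4 * h) - X 1 ^ (2 * h - 1) * X 3 ^ (2 * h + 1)

/-- `x₁ ^ (2 + i) x₂ ^ (2h - 2 - i) x₄ ^ (2 + i) - x₃ ^ (2h + 1 + i)` -/
noncomputable def p₆ (h i : ℕ) : MvPolynomial (Fin 4) k :=
  X 0 ^ (2 + i) * X 1 ^ (2 * h - 2 - i) * X 3 ^ (2 + i) - X 2 ^ (2 * h + 1 + i)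

/-- `x₁ x₂ ^ (2h - 1) x₄ - x₃ ^ (2h)` -/
noncomputable def p₇ (h : ℕ) : MvPolynomial (Fin 4) k :=
  X 0 * X 1 ^ (2 * h - 1) * X 3 - X 2 ^ (2 * h)

/-- `x₁ ^ (2h) x₄ ^ (2h) - x₃ ^ (4h - 1)` -/
noncomputable def p₈ (h : ℕ) : MvPolynomial (Fin 4) k :=
  X 0 ^ (2 * h) * X 3 ^ (2 * h) - X 2 ^ (4 * h - 1)

/-- The explicit set of binomials. -/
def basis (h : ℕ) : Set (MvPolynomial (Fin 4) k) :=
  {p₁ k, p₂ k h, p₅ k h, p₇ k h, p₈ k h}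
    ∪ {f | ∃ j, 0 ≤ j ∧ j ≤ 2 * h - 1 ∧ f = p₃ k h j}
    ∪ {f | ∃ i, 1 ≤ i ∧ i ≤ 2 * h ∧ f = p₄ k h i}
    ∪ {f | ∃ i, 0 ≤ i ∧ i ≤ 2 * h - 3 ∧ f = p₆ k h i}

end Bresinsky

/-!
Under `x_i ↦ t ^ n_i` a monomial `x ^ a` goes to `t ^ w(a)`, with the weight `w(a) = ∑ a_i n_i`.
Let `G` be a set of binomials `x ^ a - x ^ b` with `w(a) = w(b)`. Rewriting with `G` turns any
monomial into a standard one (divisible by no leading monomial of `G`) of the same weight. In a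
nonzero element of the curve ideal the leading monomial shares its weight with a smaller monomial,
since its image has to cancel. If the weight separates the standard monomials, the leading monomial
is therefore not standard, and `G` is a Gröbner basis.

For Bresinsky's curve the weights are built from the pairwise coprime numbers `2h - 1`, `2h`,
`2h + 1`, so the vectors of weight zero have the explicit form
`(u - (2h + 1) s, 2h t - u, (2h - 1) (s - t) - u, u)`. For the difference of two standard exponent
vectors, ordered so that `u ≥ 0`, the bounds satisfied by standard exponents leave only `(s, t)` in
`{(0, 0), (0, 1), (1, 1)}`, and each of these forces the two vectors to be equal.
-/

open MvPolynomial
open scoped MonomialOrder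

section MonomialCurve

variable {σ k : Type*} [Field k] {m : MonomialOrder σ} {n : σ → ℕ}

theorem aeval_X_pow_monomial {R : Type*} [CommSemiring R] (n : σ → ℕ) (a : σ →₀ ℕ) (r : R) :
    aeval (fun i ↦ (Polynomial.X : Polynomial R) ^ n i) (monomial a r) =
      Polynomial.monomial (Finsupp.weight n a) r := by
  simp only [aeval_monomial, Polynomial.algebraMap_eq, Finsupp.prod, ← pow_mul,
    Finset.prod_pow_eq_pow_sum, Polynomial.C_mul_X_pow_eq_monomial, Finsupp.weight_apply,
    Finsupp.sum, smul_eq_mul, mul_comm (n _)]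

theorem coeff_aeval_X_pow {R : Type*} [CommSemiring R] (n : σ → ℕ) (f : MvPolynomial σ R)
    (d : ℕ) :
    (aeval (fun i ↦ (Polynomial.X : Polynomial R) ^ n i) f).coeff d =
      ∑ b ∈ f.support with Finsupp.weight n b = d, f.coeff b := by
  conv_lhs => rw [f.as_sum]
  simp only [map_sum, aeval_X_pow_monomial, Polynomial.finsetSum_coeff, Polynomial.coeff_monomial,
    Finset.sum_filter]

theorem monomial_sub_monomial_mem_monomialCurveIdeal {a b : σ →₀ ℕ}
    (hab : Finsupp.weight n b = Finsupp.weight n a) :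
    monomial a (1 : k) - monomial b 1 ∈ monomialCurveIdeal k n := by
  rw [monomialCurveIdeal, RingHom.mem_ker, map_sub, aeval_X_pow_monomial, aeval_X_pow_monomial,
    hab, sub_self]

theorem exists_weight_eq_lt_degree (m : MonomialOrder σ) {f : MvPolynomial σ k}
    (hf : f ∈ monomialCurveIdeal k n) (hf0 : f ≠ 0) :
    ∃ b, Finsupp.weight n b = Finsupp.weight n (m.degree f) ∧ b ≺[m] m.degree f := by
  by_contra! hlow
  have hsingle : {b ∈ f.support | Finsupp.weight n b = Finsupp.weight n (m.degree f)} =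
      {m.degree f} := by
    refine Finset.eq_singleton_iff_unique_mem.2 ⟨by simpa using hf0, fun b hb ↦ ?_⟩
    rw [Finset.mem_filter] at hb
    exact m.toSyn.injective ((m.le_degree hb.1).antisymm (hlow b hb.2))
  have hcoeff := coeff_aeval_X_pow n f (Finsupp.weight n (m.degree f))
  rw [monomialCurveIdeal, RingHom.mem_ker] at hf
  rw [hf, Polynomial.coeff_zero, hsingle, Finset.sum_singleton] at hcoeff
  exact m.coeff_degree_ne_zero_iff.2 hf0 hcoeff.symm

/-- The exponents of the standard monomials of `G`: those divisible by the leading monomial of no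
nonzero element of `G`. -/
def standardExponents (m : MonomialOrder σ) (G : Set (MvPolynomial σ k)) : Set (σ →₀ ℕ) :=
  {a | ∀ f ∈ G, f ≠ 0 → ¬ m.degree f ≤ a}

theorem isGroebnerBasis_of_degree_notMem_standardExponents {G : Set (MvPolynomial σ k)}
    {I : Ideal (MvPolynomial σ k)} (hfin : G.Finite) (hsub : G ⊆ I)
    (hdeg : ∀ f ∈ I, f ≠ 0 → m.degree f ∉ standardExponents m G) : IsGroebnerBasis m G I := by
  refine ⟨hfin, hsub, (Ideal.span_mono (Set.image_mono hsub)).antisymm (Ideal.span_le.2 ?_)⟩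
  rintro _ ⟨f, hf, rfl⟩
  rcases eq_or_ne f 0 with rfl | hf0
  · simp
  obtain ⟨g, hg, hg0, hle⟩ : ∃ g ∈ G, g ≠ 0 ∧ m.degree g ≤ m.degree f := by
    simpa [standardExponents] using hdeg f hf hf0
  have hmul : m.leadingTerm f =
      monomial (m.degree f - m.degree g) (m.leadingCoeff f / m.leadingCoeff g) *
        m.leadingTerm g := by
    rw [MonomialOrder.leadingTerm, MonomialOrder.leadingTerm, monomial_mul,
      tsub_add_cancel_of_le hle, div_mul_cancel₀ _ (m.leadingCoeff_ne_zero_iff.2 hg0)]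
  rw [SetLike.mem_coe, hmul]
  exact Ideal.mul_mem_left _ _ (Ideal.subset_span ⟨g, hg, rfl⟩)

/-- `f` is the binomial `x ^ a - x ^ b`, with leading monomial `x ^ a`, and it vanishes on the
monomial curve with exponents `n`. -/
structure IsCurveBinomial (m : MonomialOrder σ) (n : σ → ℕ) (a b : σ →₀ ℕ)
    (f : MvPolynomial σ k) : Prop where
  eq_sub : f = monomial a 1 - monomial b 1
  lt : b ≺[m] a
  weight_eq : Finsupp.weight n b = Finsupp.weight n a

namespace IsCurveBinomial

variable {a b : σ →₀ ℕ} {f : MvPolynomial σ k}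

theorem mem_monomialCurveIdeal (hf : IsCurveBinomial m n a b f) : f ∈ monomialCurveIdeal k n :=
  hf.eq_sub ▸ monomial_sub_monomial_mem_monomialCurveIdeal hf.weight_eq

theorem degree_eq (hf : IsCurveBinomial m n a b f) : m.degree f = a := by
  classical
  have hlt : m.degree (monomial b (1 : k)) ≺[m] m.degree (monomial a (1 : k)) := by
    simpa [m.degree_monomial] using hf.lt
  rw [hf.eq_sub, m.degree_sub_of_lt hlt, m.degree_monomial, if_neg one_ne_zero]

theorem ne_zero (hf : IsCurveBinomial m n a b f) : f ≠ 0 := by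
  have hne : a ≠ b := fun hab ↦ hf.lt.ne (congrArg m.toSyn hab.symm)
  rw [hf.eq_sub, sub_ne_zero]
  exact fun hab ↦ hne (monomial_left_injective one_ne_zero hab)

theorem not_le_of_mem_standardExponents (hf : IsCurveBinomial m n a b f)
    {G : Set (MvPolynomial σ k)} (hfG : f ∈ G) {e : σ →₀ ℕ} (he : e ∈ standardExponents m G) :
    ¬ a ≤ e :=
  hf.degree_eq ▸ he f hfG hf.ne_zero

end IsCurveBinomial

theorem exists_mem_standardExponents_weight_eq_le {G : Set (MvPolynomial σ k)}
    (hG : ∀ f ∈ G, ∃ a b, IsCurveBinomial m n a b f) (c : σ →₀ ℕ) :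
    ∃ e ∈ standardExponents m G, Finsupp.weight n e = Finsupp.weight n c ∧ e ≼[m] c := by
  induction c using (InvImage.wf m.toSyn wellFounded_lt).induction with
  | _ c ih =>
    by_cases hc : c ∈ standardExponents m G
    · exact ⟨c, hc, rfl, le_rfl⟩
    obtain ⟨f, hfG, -, hle⟩ : ∃ f ∈ G, f ≠ 0 ∧ m.degree f ≤ c := by
      simpa [standardExponents] using hc
    obtain ⟨a, b, hf⟩ := hG f hfG
    obtain ⟨d, rfl⟩ := exists_add_of_le (hf.degree_eq ▸ hle)
    have hlt : b + d ≺[m] a + d := by simpa using hf.lt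
    obtain ⟨e, he, hweight, hed⟩ := ih (b + d) hlt
    exact ⟨e, he, by rw [hweight, map_add, map_add, hf.weight_eq], hed.trans hlt.le⟩

theorem isGroebnerBasis_monomialCurveIdeal_of_injOn_weight {G : Set (MvPolynomial σ k)}
    (hfin : G.Finite) (hG : ∀ f ∈ G, ∃ a b, IsCurveBinomial m n a b f)
    (hinj : Set.InjOn (Finsupp.weight n) (standardExponents m G)) :
    IsGroebnerBasis m G (monomialCurveIdeal k n) := by
  refine isGroebnerBasis_of_degree_notMem_standardExponents hfin (fun f hf ↦ ?_)
    fun f hf hf0 hstd ↦ ?_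
  · obtain ⟨a, b, hab⟩ := hG f hf
    exact hab.mem_monomialCurveIdeal
  · obtain ⟨b, hweight, hlt⟩ := exists_weight_eq_lt_degree m hf hf0
    obtain ⟨e, he, hweight', hle⟩ := exists_mem_standardExponents_weight_eq_le hG b
    exact (hle.trans_lt hlt).ne (congrArg _ (hinj he hstd (hweight'.trans hweight)))

end MonomialCurve

namespace Bresinsky

section ExponentVectors

/-- The exponent vector of the monomial `x₁ ^ a x₂ ^ b x₃ ^ c x₄ ^ d`. -/
noncomputable def expVec (a b c d : ℕ) : Fin 4 →₀ ℕ :=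
  Finsupp.equivFunOnFinite.symm ![a, b, c, d]

variable {a b c d a' b' c' d' : ℕ}

theorem expVec_le_iff {e : Fin 4 →₀ ℕ} :
    expVec a b c d ≤ e ↔ a ≤ e 0 ∧ b ≤ e 1 ∧ c ≤ e 2 ∧ d ≤ e 3 := by
  simp [Finsupp.le_def, Fin.forall_fin_succ, expVec]

theorem degree_expVec (a b c d : ℕ) : (expVec a b c d).degree = a + b + c + d := by
  simp [Finsupp.degree_eq_sum, Fin.sum_univ_succ, expVec, add_assoc]

theorem monomial_expVec {R : Type*} [CommSemiring R] (a b c d : ℕ) :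
    monomial (expVec a b c d) (1 : R) = X 0 ^ a * X 1 ^ b * X 2 ^ c * X 3 ^ d := by
  rw [monomial_eq, map_one, one_mul, Finsupp.prod_fintype _ _ (by simp)]
  simp [Fin.prod_univ_succ, expVec, mul_assoc]

theorem expVec_lt_of_degree_lt (hdeg : a + b + c + d < a' + b' + c' + d') :
    expVec a b c d ≺[MonomialOrder.degRevLex (Fin 4)] expVec a' b' c' d' := by
  rw [MonomialOrder.degRevLex_lt_iff, degree_expVec, degree_expVec]
  exact Or.inl hdeg

theorem expVec_lt_of_last_lt (hdeg : a + b + c + d = a' + b' + c' + d') (hlast : d' < d) :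
    expVec a b c d ≺[MonomialOrder.degRevLex (Fin 4)] expVec a' b' c' d' := by
  rw [MonomialOrder.degRevLex_lt_iff, degree_expVec, degree_expVec]
  exact Or.inr ⟨hdeg, 3, fun j hj ↦ absurd hj (Fin.le_last j).not_gt, hlast⟩

theorem cast_weight_exponents {h : ℕ} (hh : 1 ≤ h) (e : Fin 4 →₀ ℕ) :
    (Finsupp.weight (exponents h) e : ℤ) =
      e 0 * ((2 * h - 1) * (2 * h)) + e 1 * ((2 * h - 1) * (2 * h + 1)) +
        e 2 * (2 * h * (2 * h + 1)) + e 3 * (2 * h * (2 * h + 1) + (2 * h - 1)) := by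
  have hsub : ((2 * h - 1 : ℕ) : ℤ) = 2 * h - 1 := by omega
  simp [Finsupp.weight_apply, Finsupp.sum_fintype, Fin.sum_univ_four, exponents, hsub]

theorem weight_expVec_eq {h : ℕ} (hh : 1 ≤ h)
    (hab : (a * ((2 * h - 1) * (2 * h)) + b * ((2 * h - 1) * (2 * h + 1)) +
        c * (2 * h * (2 * h + 1)) + d * (2 * h * (2 * h + 1) + (2 * h - 1)) : ℤ) =
      a' * ((2 * h - 1) * (2 * h)) + b' * ((2 * h - 1) * (2 * h + 1)) +
        c' * (2 * h * (2 * h + 1)) + d' * (2 * h * (2 * h + 1) + (2 * h - 1))) :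
    Finsupp.weight (exponents h) (expVec a b c d) =
      Finsupp.weight (exponents h) (expVec a' b' c' d') := by
  zify
  rw [cast_weight_exponents hh, cast_weight_exponents hh]
  exact hab

end ExponentVectors

section Binomials

variable (k : Type*) [Field k] {h : ℕ}

theorem isCurveBinomial_p₁ (hh : 1 ≤ h) :
    IsCurveBinomial (MonomialOrder.degRevLex (Fin 4)) (exponents h)
      (expVec 0 1 1 0) (expVec 1 0 0 1) (p₁ k) where
  eq_sub := by simp [p₁, monomial_expVec]
  lt := expVec_lt_of_last_lt rfl one_pos
  weight_eq := weight_expVec_eq hh (by push_cast; ring)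

theorem isCurveBinomial_p₂ (hh : 1 ≤ h) :
    IsCurveBinomial (MonomialOrder.degRevLex (Fin 4)) (exponents h)
      (expVec 0 (2 * h) 0 0) (expVec 0 0 (2 * h - 1) 0) (p₂ k h) where
  eq_sub := by simp [p₂, monomial_expVec]
  lt := expVec_lt_of_degree_lt (by omega)
  weight_eq := weight_expVec_eq hh (by
    rw [Nat.cast_sub (by omega)]
    push_cast
    ring)

theorem isCurveBinomial_p₃ (hh : 1 ≤ h) {j : ℕ} (hj : j ≤ 2 * h) :
    IsCurveBinomial (MonomialOrder.degRevLex (Fin 4)) (exponents h)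
      (expVec (j + 1) 0 (2 * h - j) 0) (expVec 0 j 0 (2 * h - j)) (p₃ k h j) where
  eq_sub := by simp [p₃, monomial_expVec]
  lt := expVec_lt_of_degree_lt (by omega)
  weight_eq := weight_expVec_eq hh (by
    rw [Nat.cast_sub hj]
    push_cast
    ring)

theorem isCurveBinomial_p₄ (hh : 1 ≤ h) {i : ℕ} (hi : 1 ≤ i) (hi' : i ≤ 2 * h) :
    IsCurveBinomial (MonomialOrder.degRevLex (Fin 4)) (exponents h)
      (expVec (i + 1) (2 * h - i) 0 0) (expVec 0 0 (i - 1) (2 * h - i)) (p₄ k h i) where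
  eq_sub := by simp [p₄, monomial_expVec]
  lt := expVec_lt_of_degree_lt (by omega)
  weight_eq := weight_expVec_eq hh (by
    rw [Nat.cast_sub hi, Nat.cast_sub hi']
    push_cast
    ring)

theorem isCurveBinomial_p₅ (hh : 1 ≤ h) :
    IsCurveBinomial (MonomialOrder.degRevLex (Fin 4)) (exponents h)
      (expVec 0 0 (4 * h) 0) (expVec 0 (2 * h - 1) 0 (2 * h + 1)) (p₅ k h) where
  eq_sub := by simp [p₅, monomial_expVec]
  lt := expVec_lt_of_last_lt (by omega) (by omega)
  weight_eq := weight_expVec_eq hh (by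
    rw [Nat.cast_sub (by omega)]
    push_cast
    ring)

theorem isCurveBinomial_p₆ {i : ℕ} (hi : i + 2 ≤ 2 * h) :
    IsCurveBinomial (MonomialOrder.degRevLex (Fin 4)) (exponents h)
      (expVec (2 + i) (2 * h - 2 - i) 0 (2 + i)) (expVec 0 0 (2 * h + 1 + i) 0) (p₆ k h i) where
  eq_sub := by simp [p₆, monomial_expVec]
  lt := expVec_lt_of_degree_lt (by omega)
  weight_eq := weight_expVec_eq (by omega) (by
    rw [Nat.cast_sub (by omega), Nat.cast_sub (by omega)]
    push_cast
    ring)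

theorem isCurveBinomial_p₇ (hh : 1 ≤ h) :
    IsCurveBinomial (MonomialOrder.degRevLex (Fin 4)) (exponents h)
      (expVec 1 (2 * h - 1) 0 1) (expVec 0 0 (2 * h) 0) (p₇ k h) where
  eq_sub := by simp [p₇, monomial_expVec]
  lt := expVec_lt_of_degree_lt (by omega)
  weight_eq := weight_expVec_eq hh (by
    rw [Nat.cast_sub (by omega)]
    push_cast
    ring)

theorem isCurveBinomial_p₈ (hh : 1 ≤ h) :
    IsCurveBinomial (MonomialOrder.degRevLex (Fin 4)) (exponents h)
      (expVec (2 * h) 0 0 (2 * h)) (expVec 0 0 (4 * h - 1) 0) (p₈ k h) where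
  eq_sub := by simp [p₈, monomial_expVec]
  lt := expVec_lt_of_degree_lt (by omega)
  weight_eq := weight_expVec_eq hh (by
    rw [Nat.cast_sub (by omega)]
    push_cast
    ring)

theorem finite_basis (h : ℕ) : (basis k h).Finite := by
  have hfam (I : ℕ → Prop) (N : ℕ) (p : ℕ → MvPolynomial (Fin 4) k) :
      {f | ∃ i, I i ∧ i ≤ N ∧ f = p i}.Finite :=
    ((Set.finite_Iic N).image p).subset fun _ ⟨i, _, hi, hf⟩ ↦ ⟨i, hi, hf.symm⟩
  exact (((Set.toFinite _).union (hfam _ _ _)).union (hfam _ _ _)).union (hfam _ _ _)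

theorem p₁_mem_basis (h : ℕ) : p₁ k ∈ basis k h := by simp [basis]

theorem p₂_mem_basis (h : ℕ) : p₂ k h ∈ basis k h := by simp [basis]

theorem p₃_mem_basis {j : ℕ} (hj : j ≤ 2 * h - 1) : p₃ k h j ∈ basis k h :=
  Or.inl (Or.inl (Or.inr ⟨j, j.zero_le, hj, rfl⟩))

theorem p₄_mem_basis {i : ℕ} (hi : 1 ≤ i) (hi' : i ≤ 2 * h) : p₄ k h i ∈ basis k h :=
  Or.inl (Or.inr ⟨i, hi, hi', rfl⟩)

theorem p₅_mem_basis (h : ℕ) : p₅ k h ∈ basis k h := by simp [basis]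

theorem p₆_mem_basis {i : ℕ} (hi : i ≤ 2 * h - 3) : p₆ k h i ∈ basis k h :=
  Or.inr ⟨i, i.zero_le, hi, rfl⟩

theorem p₇_mem_basis (h : ℕ) : p₇ k h ∈ basis k h := by simp [basis]

theorem p₈_mem_basis (h : ℕ) : p₈ k h ∈ basis k h := by simp [basis]

theorem exists_isCurveBinomial_of_mem_basis (hh : 1 ≤ h) {f : MvPolynomial (Fin 4) k}
    (hf : f ∈ basis k h) :
    ∃ a b, IsCurveBinomial (MonomialOrder.degRevLex (Fin 4)) (exponents h) a b f := by
  rcases hf with (((rfl | rfl | rfl | rfl | rfl) | ⟨j, -, hj, rfl⟩) | ⟨i, hi, hi', rfl⟩) |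
    ⟨i, -, hi, rfl⟩
  · exact ⟨_, _, isCurveBinomial_p₁ k hh⟩
  · exact ⟨_, _, isCurveBinomial_p₂ k hh⟩
  · exact ⟨_, _, isCurveBinomial_p₅ k hh⟩
  · exact ⟨_, _, isCurveBinomial_p₇ k hh⟩
  · exact ⟨_, _, isCurveBinomial_p₈ k hh⟩
  · exact ⟨_, _, isCurveBinomial_p₃ k hh (by omega)⟩
  · exact ⟨_, _, isCurveBinomial_p₄ k hh hi hi'⟩
  · exact ⟨_, _, isCurveBinomial_p₆ k (by omega)⟩

end Binomials

section StandardExponents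

variable {k : Type*} [Field k] {h : ℕ} {e : Fin 4 →₀ ℕ} (hh : 1 ≤ h)
  (he : e ∈ standardExponents (MonomialOrder.degRevLex (Fin 4)) (basis k h))

include hh he

theorem apply_one_eq_zero_or_apply_two_eq_zero_of_mem_standardExponents : e 1 = 0 ∨ e 2 = 0 := by
  have hp₁ :=
    (isCurveBinomial_p₁ k hh).not_le_of_mem_standardExponents (p₁_mem_basis k h) he
  rw [expVec_le_iff] at hp₁
  omega

theorem apply_one_lt_of_mem_standardExponents : e 1 < 2 * h := by
  have hp₂ :=
    (isCurveBinomial_p₂ k hh).not_le_of_mem_standardExponents (p₂_mem_basis k h) he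
  rw [expVec_le_iff] at hp₂
  omega

theorem apply_two_lt_of_mem_standardExponents : e 2 < 4 * h := by
  have hp₅ :=
    (isCurveBinomial_p₅ k hh).not_le_of_mem_standardExponents (p₅_mem_basis k h) he
  rw [expVec_le_iff] at hp₅
  omega

theorem apply_zero_add_apply_one_le_of_mem_standardExponents : e 0 + e 1 ≤ 2 * h := by
  have hp₄ {i : ℕ} (hi : 1 ≤ i) (hi' : i ≤ 2 * h) : ¬ expVec (i + 1) (2 * h - i) 0 0 ≤ e :=
    (isCurveBinomial_p₄ k hh hi hi').not_le_of_mem_standardExponents (p₄_mem_basis k hi hi') he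
  simp only [expVec_le_iff] at hp₄
  have hlt := apply_one_lt_of_mem_standardExponents hh he
  by_contra! hgt
  rcases le_or_gt (e 0) (2 * h) with hle | hlarge
  · exact hp₄ (i := e 0 - 1) (by omega) (by omega) (by omega)
  · exact hp₄ (i := 2 * h) (by omega) le_rfl (by omega)

theorem apply_zero_add_apply_two_le_of_mem_standardExponents (h0 : e 0 ≠ 0) (h2 : e 2 ≠ 0) :
    e 0 + e 2 ≤ 2 * h := by
  have hle := apply_zero_add_apply_one_le_of_mem_standardExponents hh he
  have hp₃ := (isCurveBinomial_p₃ k hh (j := e 0 - 1) (by omega)).not_le_of_mem_standardExponents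
    (p₃_mem_basis k (by omega)) he
  rw [expVec_le_iff] at hp₃
  omega

theorem apply_zero_add_apply_two_lt_of_mem_standardExponents : e 0 + e 2 < 4 * h := by
  have h01 := apply_zero_add_apply_one_le_of_mem_standardExponents hh he
  have h02 := apply_zero_add_apply_two_le_of_mem_standardExponents hh he
  have h2 := apply_two_lt_of_mem_standardExponents hh he
  omega

theorem apply_three_lt_apply_zero_of_mem_standardExponents (hsum : e 0 + e 1 = 2 * h) :
    e 3 < e 0 := by
  have hlt := apply_one_lt_of_mem_standardExponents hh he
  rcases (by omega : e 0 = 1 ∨ e 0 = 2 * h ∨ 2 ≤ e 0 ∧ e 0 < 2 * h) with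
    hone | htop | ⟨htwo, hmid⟩
  · have hp₇ :=
      (isCurveBinomial_p₇ k hh).not_le_of_mem_standardExponents (p₇_mem_basis k h) he
    rw [expVec_le_iff] at hp₇
    omega
  · have hp₈ :=
      (isCurveBinomial_p₈ k hh).not_le_of_mem_standardExponents (p₈_mem_basis k h) he
    rw [expVec_le_iff] at hp₈
    omega
  · have hp₆ :=
      (isCurveBinomial_p₆ k (h := h) (i := e 0 - 2) (by omega)).not_le_of_mem_standardExponents
        (p₆_mem_basis k (by omega)) he
    rw [expVec_le_iff] at hp₆
    omega

end StandardExponents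

section Lattice

theorem exists_lattice_coordinates {h u₁ u₂ u₃ u₄ : ℤ} (hh : h ≠ 0)
    (hu : u₁ * ((2 * h - 1) * (2 * h)) + u₂ * ((2 * h - 1) * (2 * h + 1)) +
      u₃ * (2 * h * (2 * h + 1)) + u₄ * (2 * h * (2 * h + 1) + (2 * h - 1)) = 0) :
    ∃ s t : ℤ, u₁ = u₄ - (2 * h + 1) * s ∧ u₂ = 2 * h * t - u₄ ∧
      u₃ = (2 * h - 1) * (s - t) - u₄ := by
  -- Modulo `2h + 1` the relation reads `2 (u₁ - u₄) = 0`, and modulo `2h` it reads `u₂ + u₄ = 0`.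
  obtain ⟨s, hs⟩ : 2 * h + 1 ∣ u₄ - u₁ := by
    have hcoprime : IsCoprime (2 * h + 1) 2 := ⟨1, -h, by ring⟩
    refine hcoprime.dvd_of_dvd_mul_right ⟨u₁ * (2 * h - 2) + u₂ * (2 * h - 1)
      + u₃ * (2 * h) + u₄ * (2 * h + 1), ?_⟩
    linear_combination -hu
  obtain ⟨t, ht⟩ : 2 * h ∣ u₂ + u₄ :=
    ⟨u₁ * (2 * h - 1) + u₂ * (2 * h) + u₃ * (2 * h + 1) + u₄ * (2 * h + 2), by
      linear_combination -hu⟩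
  refine ⟨s, t, by linear_combination -hs, by linear_combination ht, ?_⟩
  have hprod : 2 * h * (2 * h + 1) ≠ 0 := mul_ne_zero (by omega) (by omega)
  refine mul_left_cancel₀ hprod ?_
  linear_combination hu + (2 * h - 1) * (2 * h) * hs - (2 * h - 1) * (2 * h + 1) * ht

theorem lattice_coordinates_cases {m s t : ℤ} (hm : 1 ≤ m) (hs : 0 ≤ s) (ht : 0 ≤ t)
    (hlow : -m ≤ m * t - (m + 1) * s) (hupp : m * t - (m + 1) * s ≤ m)
    (hsum : (m - 1) * t + 2 * s < 2 * m) :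
    s = 0 ∧ t = 0 ∨ s = 0 ∧ t = 1 ∨ s = 1 ∧ t = 1 := by
  have ht1 : t ≤ 1 := by
    by_contra! ht2
    have hs0 : s = 0 := by linarith [mul_le_mul_of_nonneg_left ht2 (sub_nonneg.2 hm)]
    subst hs0
    linarith [mul_le_mul_of_nonneg_left ht2 (zero_le_one.trans hm)]
  obtain rfl | rfl : t = 0 ∨ t = 1 := by omega
  · have hs1 : s < 1 := by nlinarith
    omega
  · have hs2 : s < 2 := by nlinarith
    omega

theorem injOn_weight_standardExponents (k : Type*) [Field k] {h : ℕ} (hh : 1 ≤ h) :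
    Set.InjOn (Finsupp.weight (exponents h))
      (standardExponents (MonomialOrder.degRevLex (Fin 4)) (basis k h)) := by
  intro a ha b hb hab
  wlog hba : b 3 ≤ a 3 generalizing a b
  · exact (this hb ha hab.symm (by omega)).symm
  zify at hab
  rw [cast_weight_exponents hh, cast_weight_exponents hh] at hab
  obtain ⟨s, t, h0, h1, h2⟩ := exists_lattice_coordinates (h := h) (u₁ := a 0 - b 0)
    (u₂ := a 1 - b 1) (u₃ := a 2 - b 2) (u₄ := a 3 - b 3) (by omega) (by linear_combination hab)
  have ha01 := apply_zero_add_apply_one_le_of_mem_standardExponents hh ha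
  have hb01 := apply_zero_add_apply_one_le_of_mem_standardExponents hh hb
  have hb02 := apply_zero_add_apply_two_lt_of_mem_standardExponents hh hb
  have hb1 := apply_one_lt_of_mem_standardExponents hh hb
  have hb12 := apply_one_eq_zero_or_apply_two_eq_zero_of_mem_standardExponents hh hb
  have hs : 0 ≤ s := by
    by_contra! hneg
    nlinarith
  have ht : 0 ≤ t := by
    by_contra! hneg
    nlinarith
  rcases lattice_coordinates_cases (m := 2 * h) (by omega) hs ht (by linarith) (by linarith)
    (by linarith) with ⟨rfl, rfl⟩ | ⟨rfl, rfl⟩ | ⟨rfl, rfl⟩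
  · have h3 : a 3 = b 3 := by omega
    ext i
    fin_cases i <;> simp only [Fin.mk_one, Fin.zero_eta, Fin.reduceFinMk] <;> omega
  · have hsum : a 0 + a 1 = 2 * h := by omega
    have hlt := apply_three_lt_apply_zero_of_mem_standardExponents hh ha hsum
    omega
  · have hgt : 2 * h < b 0 + b 2 := by omega
    have hle := apply_zero_add_apply_two_le_of_mem_standardExponents hh hb
    have hb0 : b 0 = 0 := by omega
    have hb1' : b 1 ≠ 0 := by omega
    have hb2' : b 2 ≠ 0 := by omega
    exact (hb12.elim hb1' hb2').elim

end Lattice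

end Bresinsky

theorem mainTheorem6 (k : Type*) [Field k] (h : ℕ) (hh : 2 ≤ h) :
    IsGroebnerBasis (MonomialOrder.degRevLex (Fin 4)) (Bresinsky.basis k h)
      (Bresinsky.curveIdeal k h) :=
  isGroebnerBasis_monomialCurveIdeal_of_injOn_weight (Bresinsky.finite_basis k h)
    (fun _ ↦ Bresinsky.exists_isCurveBinomial_of_mem_basis k (one_le_two.trans hh))
    (Bresinsky.injOn_weight_standardExponents k (one_le_two.trans hh))
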